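/- Let $n\ge 1$ be an integer. For $x,y\in\mathbb R^n$ write $x\le y$ if $x_i\le y_i$ for all $i\in\{1,\dots,n\}$, and $x<y$ if $x\le y$ and $x\ne y$. A set $A\subseteq\mathbb R^n$ is an antichain if it contains no two elements $x,y$ with $x<y$. For $i\in\{1,\dots,n\}$ let $\pi_i\colon\mathbb R^n\to\mathbb R^{n-1}$ be the projection deleting the $i$-th coordinate. For real $s\ge 0$ and an arbitrary (not necessarily measurable) set $A$ in a Euclidean space let $$\mathcal H^s(A)=\lim_{\delta\to0}\ \alpha_s\inf\Bigl\{\sum_{j}\operatorname{diam}(U_j)^s : (U_j)_j \text{ is a countable family of non-empty sets},\ A\subseteq\bigcup_j U_j,\ \operatorname{diam}(U_j)\le\delta\text{ for all }j\Bigr\}\in[0,\infty],\qquad \alpha_s=\frac{\pi^{s/2}}{2^s\,\Gamma(s/2+1)},$$ denote its $s$-dimensional Hausdorff (outer) measure, with respect to the Euclidean distance; finite and empty families are allowed and $0^0=1$, so that $\mathcal H^0$ is the counting measure. Then every antichain $A\subseteq[0,1]^n$ satisfies $$\mathcal H^{n-1}(A)\ \le\ \sum_{i=1}^n\mathcal H^{n-1}\bigl(\pi_i(A)\bigr).$$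 -/

import Mathlib

open scoped ENNReal

namespace ProjAntichain

/-- The normalising factor `α_s = π^(s/2) / (2^s Γ(s/2 + 1))`, the volume of the `s`-dimensional
ball of diameter `1`. -/
noncomputable def alpha (s : ℝ) : ℝ :=
  Real.pi ^ (s / 2) / (2 ^ s * Real.Gamma (s / 2 + 1))

/-- The normalised `s`-dimensional Hausdorff (outer) measure of an arbitrary set `A` in Euclidean
`n`-space. Mathlib's Hausdorff measure `μH[s]` is the limit, as `δ → 0`, of the infimum of
`∑ diam (U i) ^ s` over countable covers of `A` by sets of diameter at most `δ`, for every set `A`,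
measurable or not; it does not contain the factor `α_s`, which is added here. -/
noncomputable def hausdorff {n : ℕ} (s : ℝ) (A : Set (EuclideanSpace ℝ (Fin n))) : ℝ≥0∞ :=
  ENNReal.ofReal (alpha s) * MeasureTheory.Measure.hausdorffMeasure s A

/-- The unit cube `[0, 1]^n`. -/
def unitCube (n : ℕ) : Set (EuclideanSpace ℝ (Fin n)) :=
  {x | ∀ i, 0 ≤ x i ∧ x i ≤ 1}

/-- The product order: `x ≤ y` if `x i ≤ y i` for every coordinate `i`. -/
def CoordLE {n : ℕ} (x y : EuclideanSpace ℝ (Fin n)) : Prop :=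
  ∀ i, x i ≤ y i

/-- The projection `ℝ^(n+1) → ℝ^n` that deletes the `i`-th coordinate. -/
def proj {n : ℕ} (i : Fin (n + 1)) (x : EuclideanSpace ℝ (Fin (n + 1))) :
    EuclideanSpace ℝ (Fin n) :=
  WithLp.toLp 2 (fun j => x (i.succAbove j))

end ProjAntichain

/-! An antichain lies on the boundary of the up-set it generates, the zero set of an antitone `h`
(`exists_isHeight`). Along the diagonal this boundary is a Lipschitz graph, hence differentiable
almost everywhere. Its area element is at most the sum of its coordinate Jacobians, since a unit
normal has entries at most 1 in absolute value (`hausdorffMeasure_image_le_lintegral_sum_abs_det`).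
A segment of the boundary parallel to axis `i` makes the `i`-th Jacobian vanish at its lower end, so
the `i`-th projection is injective where that Jacobian is nonzero (`injOn_proj_heightParam`), and
the Jacobian integrates to at most the measure of the projection. -/

namespace ProjAntichain

open MeasureTheory MeasureTheory.Measure Set Filter Topology
open scoped NNReal Function

/-! ### Linear algebra of Jacobians -/

/-- Deleting the `i`-th coordinate, as a continuous linear map. -/
noncomputable def projCLM {n : ℕ} (i : Fin (n + 1)) :
    EuclideanSpace ℝ (Fin (n + 1)) →L[ℝ] EuclideanSpace ℝ (Fin n) :=
  LinearMap.toContinuousLinearMap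
    { toFun := proj i
      map_add' := fun x y => by ext j; simp [proj]
      map_smul' := fun c x => by ext j; simp [proj] }

@[simp] theorem projCLM_apply {n : ℕ} (i : Fin (n + 1)) (x : EuclideanSpace ℝ (Fin (n + 1))) :
    projCLM i x = proj i x := rfl

@[simp] theorem proj_apply {n : ℕ} (i : Fin (n + 1)) (x : EuclideanSpace ℝ (Fin (n + 1)))
    (j : Fin n) : proj i x j = x (i.succAbove j) := rfl

theorem det_eq_det_of_apply {n : ℕ} (T : EuclideanSpace ℝ (Fin n) →L[ℝ] EuclideanSpace ℝ (Fin n)) :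
    T.det = (Matrix.of fun i j => T (EuclideanSpace.single j 1) i).det := by
  rw [ContinuousLinearMap.det, ← LinearMap.det_toMatrix (EuclideanSpace.basisFun (Fin n) ℝ).toBasis]
  congr 1

/-- The coordinates of a vector with respect to all but the first vector of an orthonormal basis. -/
noncomputable def tailCoords {n : ℕ}
    (b : OrthonormalBasis (Fin (n + 1)) ℝ (EuclideanSpace ℝ (Fin (n + 1)))) :
    EuclideanSpace ℝ (Fin (n + 1)) →L[ℝ] EuclideanSpace ℝ (Fin n) :=
  projCLM 0 ∘L (b.repr : EuclideanSpace ℝ (Fin (n + 1)) →L[ℝ] EuclideanSpace ℝ (Fin (n + 1)))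

theorem tailCoords_apply {n : ℕ}
    (b : OrthonormalBasis (Fin (n + 1)) ℝ (EuclideanSpace ℝ (Fin (n + 1))))
    (z : EuclideanSpace ℝ (Fin (n + 1))) (j : Fin n) :
    tailCoords b z j = inner ℝ (b j.succ) z := by
  simp [tailCoords, b.repr_apply_apply]

theorem norm_le_abs_inner_add_norm_tailCoords {n : ℕ}
    (b : OrthonormalBasis (Fin (n + 1)) ℝ (EuclideanSpace ℝ (Fin (n + 1))))
    (z : EuclideanSpace ℝ (Fin (n + 1))) :
    ‖z‖ ≤ |inner ℝ (b 0) z| + ‖tailCoords b z‖ := by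
  have h : ‖z‖ ^ 2 = (inner ℝ (b 0) z) ^ 2 + ‖tailCoords b z‖ ^ 2 := by
    rw [← b.repr.norm_map z, EuclideanSpace.norm_sq_eq, EuclideanSpace.norm_sq_eq,
      Fin.sum_univ_succ]
    simp [tailCoords_apply, b.repr_apply_apply]
  refine abs_le_of_sq_le_sq' ?_ (by positivity) |>.2
  rw [h, ← sq_abs (inner ℝ (b 0) z)]
  nlinarith [mul_nonneg (abs_nonneg (inner ℝ (b 0) z)) (norm_nonneg (tailCoords b z))]

theorem abs_det_of_orthonormalBasis {m : ℕ}
    (b : OrthonormalBasis (Fin m) ℝ (EuclideanSpace ℝ (Fin m))) :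
    |(Matrix.of fun i k => b i k).det| = 1 := by
  set B : Matrix (Fin m) (Fin m) ℝ := Matrix.of fun i k => b i k
  have h : B * B.transpose = 1 := by
    ext i j
    have := orthonormal_iff_ite.1 b.orthonormal j i
    rw [PiLp.inner_apply] at this
    rw [Matrix.mul_apply, Matrix.one_apply]
    simpa [B, eq_comm] using this
  have h2 := congrArg Matrix.det h
  rw [Matrix.det_mul, Matrix.det_transpose, Matrix.det_one] at h2
  rw [← sq_eq_sq₀ (abs_nonneg _) zero_le_one, sq_abs, sq, h2, one_pow]

/-- The Jacobian of a linear map composed with an orthogonal projection onto a hyperplane is at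
most the sum of its Jacobians along the coordinate hyperplanes. -/
theorem abs_det_tailCoords_comp_le {n : ℕ}
    (b : OrthonormalBasis (Fin (n + 1)) ℝ (EuclideanSpace ℝ (Fin (n + 1))))
    (M : EuclideanSpace ℝ (Fin n) →L[ℝ] EuclideanSpace ℝ (Fin (n + 1))) :
    |(tailCoords b ∘L M).det| ≤ ∑ i, |(projCLM i ∘L M).det| := by
  set B : Matrix (Fin (n + 1)) (Fin (n + 1)) ℝ := Matrix.of fun i k => b i k with hB
  -- `W` is `M` with the normal `b 0` as an extra first column. Orthonormality makes the first
  -- column of `B * W` a unit vector, and Laplace expansion of `W` yields the coordinate minors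
  -- weighted by the entries of `b 0`.
  set W : Matrix (Fin (n + 1)) (Fin (n + 1)) ℝ :=
    Matrix.of fun i j => Fin.cases (b 0 i) (fun j => M (EuclideanSpace.single j 1) i) j with hW
  have hcol : ∀ i, (B * W) i 0 = if i = 0 then 1 else 0 := fun i => by
    have := orthonormal_iff_ite.1 b.orthonormal 0 i
    rw [PiLp.inner_apply] at this
    rw [Matrix.mul_apply]
    simpa [B, W, eq_comm] using this
  have hBW : (B * W).det = (tailCoords b ∘L M).det := by
    rw [Matrix.det_succ_column_zero, Fin.sum_univ_succ, det_eq_det_of_apply]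
    simp only [hcol, Fin.succ_ne_zero, if_true, if_false, mul_zero, zero_mul, Finset.sum_const_zero,
      add_zero, Fin.val_zero, pow_zero, one_mul]
    congr 1
    ext i j
    simp [tailCoords_apply, PiLp.inner_apply, Matrix.mul_apply, B, W, mul_comm]
  have hWdet : W.det = ∑ i : Fin (n + 1), (-1) ^ (i : ℕ) * b 0 i * (projCLM i ∘L M).det := by
    rw [Matrix.det_succ_column_zero]
    refine Finset.sum_congr rfl fun i _ => ?_
    rw [det_eq_det_of_apply]
    congr 1
  rw [← hBW, Matrix.det_mul, abs_mul, abs_det_of_orthonormalBasis, one_mul, hWdet]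
  refine (Finset.abs_sum_le_sum_abs _ _).trans (Finset.sum_le_sum fun i _ => ?_)
  have h1 : |b 0 i| ≤ 1 := by
    have := PiLp.norm_apply_le (b 0) i
    rwa [b.orthonormal.1 0, Real.norm_eq_abs] at this
  rw [abs_mul, abs_mul, abs_pow, abs_neg, abs_one, one_pow, one_mul]
  exact mul_le_of_le_one_left (abs_nonneg _) h1

theorem exists_orthonormalBasis_inner_eq_zero {n : ℕ}
    (L : EuclideanSpace ℝ (Fin n) →L[ℝ] EuclideanSpace ℝ (Fin (n + 1))) :
    ∃ b : OrthonormalBasis (Fin (n + 1)) ℝ (EuclideanSpace ℝ (Fin (n + 1))),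
      ∀ x, inner ℝ (b 0) (L x) = 0 := by
  have hne : LinearMap.range L.toLinearMap ≠ ⊤ := fun h => by
    have h1 := LinearMap.finrank_range_le L.toLinearMap
    rw [h, finrank_top] at h1
    simp at h1
  have hne' : (LinearMap.range L.toLinearMap)ᗮ ≠ ⊥ := fun h =>
    hne (Submodule.orthogonal_eq_bot_iff.1 h)
  obtain ⟨v, hv, hv0⟩ := Submodule.exists_mem_ne_zero_of_ne_bot hne'
  have hon : Orthonormal ℝ (({0} : Set (Fin (n + 1))).domRestrict
      (fun _ => (‖v‖⁻¹ : ℝ) • v)) := by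
    refine ⟨fun i => ?_, fun i j hij => (hij (Subsingleton.elim _ _)).elim⟩
    simp [Set.domRestrict, norm_smul, hv0]
  obtain ⟨b, hb⟩ := hon.exists_orthonormalBasis_extension_of_card_eq (by simp)
  refine ⟨b, fun x => ?_⟩
  have hx : inner ℝ (L x) v = 0 := (Submodule.mem_orthogonal _ v).1 hv _ ⟨x, rfl⟩
  rw [hb 0 rfl, real_inner_smul_left, real_inner_comm, hx, mul_zero]

/-! ### Area inequality for hypersurfaces -/

instance isAddHaarMeasure_hausdorffMeasure_euclideanSpace (n : ℕ) :
    IsAddHaarMeasure (μH[(n : ℝ)] : Measure (EuclideanSpace ℝ (Fin n))) := by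
  simpa using isAddHaarMeasure_hausdorffMeasure (E := EuclideanSpace ℝ (Fin n))

/-- The bound makes `f` factor through `g` on `s`, by a map that is `c`-Lipschitz on `g '' s`. -/
theorem hausdorffMeasure_image_le_of_norm_sub_le {X E F : Type*} [NormedAddCommGroup E]
    [MeasurableSpace E] [BorelSpace E] [NormedAddCommGroup F] [MeasurableSpace F] [BorelSpace F]
    {f : X → E} {g : X → F} {s : Set X} {c : ℝ≥0} {d : ℝ} (hd : 0 ≤ d)
    (h : ∀ x ∈ s, ∀ y ∈ s, ‖f x - f y‖ ≤ c * ‖g x - g y‖) :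
    μH[d] (f '' s) ≤ (c : ℝ≥0∞) ^ d * μH[d] (g '' s) := by
  rcases s.eq_empty_or_nonempty with rfl | ⟨x₀, hx₀⟩
  · simp
  have : Nonempty X := ⟨x₀⟩
  set r := f ∘ Function.invFunOn g s
  have hr : ∀ x ∈ s, r (g x) = f x := fun x hx => by
    have hm := Function.invFunOn_apply_mem (f := g) hx
    have he := Function.invFunOn_apply_eq (f := g) hx
    have := h _ hm _ hx
    rw [he, sub_self, norm_zero, mul_zero] at this
    exact sub_eq_zero.1 (norm_le_zero_iff.1 this)
  have hlip : LipschitzOnWith c r (g '' s) := by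
    refine LipschitzOnWith.of_dist_le_mul ?_
    rintro _ ⟨x, hx, rfl⟩ _ ⟨y, hy, rfl⟩
    rw [hr x hx, hr y hy, dist_eq_norm, dist_eq_norm]
    exact h x hx y hy
  have himg : f '' s = r '' (g '' s) := by
    rw [image_image]
    exact image_congr fun x hx => (hr x hx).symm
  rw [himg]
  exact hlip.hausdorffMeasure_image_le hd

section Area

variable {n : ℕ} {F : EuclideanSpace ℝ (Fin n) → EuclideanSpace ℝ (Fin (n + 1))}
  {F' : EuclideanSpace ℝ (Fin n) → EuclideanSpace ℝ (Fin n) →L[ℝ] EuclideanSpace ℝ (Fin (n + 1))}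
  {S : Set (EuclideanSpace ℝ (Fin n))}

/-- With `b 0` normal to the range of `L`, a chord of `F '' S` has normal part at most `ε * K` times
its length. So `tailCoords b` shrinks chords by at most the factor `c`, and change of variables
applies in the tangent hyperplane. -/
theorem hausdorffMeasure_image_le_of_approximatesLinearOn
    {L : EuclideanSpace ℝ (Fin n) →L[ℝ] EuclideanSpace ℝ (Fin (n + 1))} {K ε c : ℝ≥0}
    (hS : MeasurableSet S) (hF' : ∀ x ∈ S, HasFDerivAt F (F' x) x)
    (hK : ∀ x y, ‖x - y‖ ≤ K * ‖F x - F y‖) (hL : ApproximatesLinearOn F L S ε)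
    (hc : 1 + c * (ε * K) ≤ c) :
    μH[n] (F '' S) ≤ (c : ℝ≥0∞) ^ (n : ℝ) *
      ∫⁻ x in S, ∑ i, ENNReal.ofReal |(projCLM i ∘L F' x).det| ∂μH[n] := by
  obtain ⟨b, hb⟩ := exists_orthonormalBasis_inner_eq_zero L
  have hc' : (1 : ℝ) + c * (ε * K) ≤ c := by exact_mod_cast hc
  have key : ∀ x ∈ S, ∀ y ∈ S,
      ‖F x - F y‖ ≤ c * ‖(tailCoords b ∘ F) x - (tailCoords b ∘ F) y‖ := fun x hx y hy => by
    have h1 := norm_le_abs_inner_add_norm_tailCoords b (F x - F y)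
    have h2 : |inner ℝ (b 0) (F x - F y)| ≤ ε * K * ‖F x - F y‖ := by
      have h3 : inner ℝ (b 0) (F x - F y) = inner ℝ (b 0) (F x - F y - L (x - y)) := by
        rw [inner_sub_right _ _ (L (x - y)), hb, sub_zero]
      calc |inner ℝ (b 0) (F x - F y)| ≤ ‖b 0‖ * ‖F x - F y - L (x - y)‖ := by
            rw [h3]; exact abs_real_inner_le_norm _ _
        _ ≤ 1 * (ε * ‖x - y‖) := by
            rw [b.orthonormal.1 0]; gcongr; exact hL x hx y hy
        _ ≤ 1 * (ε * (K * ‖F x - F y‖)) := by gcongr; exact hK x y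
        _ = ε * K * ‖F x - F y‖ := by ring
    rw [map_sub] at h1
    simp only [Function.comp_apply]
    have h4 : ‖F x - F y‖ ≤ ε * K * ‖F x - F y‖ + ‖tailCoords b (F x) - tailCoords b (F y)‖ :=
      h1.trans (by gcongr)
    have h5 := mul_le_mul_of_nonneg_left h4 c.coe_nonneg
    have h6 := mul_le_mul_of_nonneg_right hc' (norm_nonneg (F x - F y))
    linarith
  refine (hausdorffMeasure_image_le_of_norm_sub_le n.cast_nonneg key).trans ?_
  gcongr
  refine (addHaar_image_le_lintegral_abs_det_fderiv μH[n] hS (f' := fun x => tailCoords b ∘L F' x)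
    fun x hx => ((tailCoords b).hasFDerivAt.comp x (hF' x hx)).hasFDerivWithinAt).trans ?_
  refine lintegral_mono fun x => ?_
  rw [← ENNReal.ofReal_sum_of_nonneg fun i _ => abs_nonneg _]
  exact ENNReal.ofReal_le_ofReal (abs_det_tailCoords_comp_le b (F' x))

/-- The `n`-dimensional measure of a parametrized hypersurface is at most the sum of the
integrals of its Jacobians along the coordinate hyperplanes. -/
theorem hausdorffMeasure_image_le_lintegral_sum_abs_det {K : ℝ≥0}
    (hS : MeasurableSet S) (hF' : ∀ x ∈ S, HasFDerivAt F (F' x) x)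
    (hK : ∀ x y, ‖x - y‖ ≤ K * ‖F x - F y‖) :
    μH[n] (F '' S) ≤ ∫⁻ x in S, ∑ i, ENNReal.ofReal |(projCLM i ∘L F' x).det| ∂μH[n] := by
  set J : EuclideanSpace ℝ (Fin n) → ℝ≥0∞ := fun x =>
    ∑ i, ENNReal.ofReal |(projCLM i ∘L F' x).det|
  have main : ∀ c : ℝ≥0, 1 < c →
      μH[n] (F '' S) ≤ (c : ℝ≥0∞) ^ (n : ℝ) * ∫⁻ x in S, J x ∂μH[n] := fun c hc => by
    have hc0 : 0 < c := zero_lt_one.trans hc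
    -- `K + 1` rather than `K` keeps the denominator positive when `K = 0`.
    set ε : ℝ≥0 := (c - 1) / (c * (K + 1))
    have hε : ε ≠ 0 := (div_pos (tsub_pos_of_lt hc) (by positivity)).ne'
    have hcε : 1 + c * (ε * K) ≤ c := by
      have : c * (ε * K) ≤ c - 1 := by
        calc c * (ε * K) ≤ c * (ε * (K + 1)) := by gcongr; simp
          _ = c - 1 := by simp only [ε]; field_simp
      calc 1 + c * (ε * K) ≤ 1 + (c - 1) := by gcongr
        _ = c := add_tsub_cancel_of_le hc.le
    obtain ⟨t, L, hdisj, hmeas, hcover, happrox, -⟩ :=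
      exists_partition_approximatesLinearOn_of_hasFDerivWithinAt F S F'
        (fun x hx => (hF' x hx).hasFDerivWithinAt) (fun _ => ε) fun _ => hε
    have hSt : S = ⋃ k, S ∩ t k := by rw [← inter_iUnion, inter_eq_left.2 hcover]
    calc μH[n] (F '' S) ≤ ∑' k, μH[n] (F '' (S ∩ t k)) := by
          conv_lhs => rw [hSt, image_iUnion]
          exact measure_iUnion_le _
      _ ≤ ∑' k, (c : ℝ≥0∞) ^ (n : ℝ) * ∫⁻ x in S ∩ t k, J x ∂μH[n] :=
          ENNReal.tsum_le_tsum fun k => hausdorffMeasure_image_le_of_approximatesLinearOn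
            (hS.inter (hmeas k)) (fun x hx => hF' x hx.1) hK (happrox k) hcε
      _ = (c : ℝ≥0∞) ^ (n : ℝ) * ∫⁻ x in S, J x ∂μH[n] := by
          rw [ENNReal.tsum_mul_left]
          conv_rhs => rw [hSt]
          rw [lintegral_iUnion (fun k => hS.inter (hmeas k))
            fun i j hij => (hdisj hij).mono inter_subset_right inter_subset_right]
  have hlim : Tendsto (fun c : ℝ≥0 => (c : ℝ≥0∞) ^ (n : ℝ) * ∫⁻ x in S, J x ∂μH[n])
      (𝓝[>] 1) (𝓝 (((1 : ℝ≥0) : ℝ≥0∞) ^ (n : ℝ) * ∫⁻ x in S, J x ∂μH[n])) := by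
    refine Tendsto.mono_left ?_ nhdsWithin_le_nhds
    refine ENNReal.Tendsto.mul_const ?_ (Or.inl (by simp))
    exact (ENNReal.continuous_rpow_const.tendsto _).comp (ENNReal.tendsto_coe.2 tendsto_id)
  rw [ENNReal.coe_one, ENNReal.one_rpow, one_mul] at hlim
  refine ge_of_tendsto hlim ?_
  filter_upwards [self_mem_nhdsWithin] with c hc using main c hc

end Area

/-! ### Height functions and the diagonal parametrization -/

/-- The vector all of whose coordinates are `1`. -/
noncomputable def ones (n : ℕ) : EuclideanSpace ℝ (Fin n) := WithLp.toLp 2 fun _ => 1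

@[simp] theorem ones_apply {n : ℕ} (j : Fin n) : ones n j = 1 := rfl

/-- A function that is antitone for the product order and decreases at unit speed in the diagonal
direction. Its zero set is the boundary of the up-set on which it is nonpositive. -/
structure IsHeight {n : ℕ} (h : EuclideanSpace ℝ (Fin n) → ℝ) : Prop where
  anti : ∀ z w, CoordLE z w → h w ≤ h z
  add_smul_ones : ∀ z t, h (z + t • ones n) = h z - t

theorem exists_isHeight {n : ℕ} {A : Set (EuclideanSpace ℝ (Fin (n + 1)))}
    (hA : IsAntichain CoordLE A) (hcube : A ⊆ unitCube (n + 1)) (hne : A.Nonempty) :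
    ∃ h : EuclideanSpace ℝ (Fin (n + 1)) → ℝ, IsHeight h ∧ ∀ z ∈ A, h z = 0 := by
  have : Nonempty A := hne.to_subtype
  -- `g x z` is the least `t` with `x ≤ z + t • ones`; the height is its infimum over `x ∈ A`. A
  -- negative value at `z ∈ A` would put some point of `A` strictly below `z`.
  set g : EuclideanSpace ℝ (Fin (n + 1)) → EuclideanSpace ℝ (Fin (n + 1)) → ℝ :=
    fun x z => Finset.univ.sup' Finset.univ_nonempty fun j => x j - z j
  have hg : ∀ x z j, x j - z j ≤ g x z := fun x z j =>
    Finset.le_sup' (fun j => x j - z j) (Finset.mem_univ j)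
  have hbdd : ∀ z, BddBelow (range fun x : A => g x z) := fun z => by
    refine ⟨-z 0, ?_⟩
    rintro _ ⟨x, rfl⟩
    have := hg x z 0
    have := (hcube x.2 0).1
    simp only
    linarith
  have hanti : ∀ z w, CoordLE z w → (⨅ x : A, g x w) ≤ ⨅ x : A, g x z := fun z w hzw =>
    ciInf_mono (hbdd w) fun x => Finset.sup'_le _ _ fun j _ => by
      have := hg x z j
      have := hzw j
      linarith
  have hle : ∀ z t, (⨅ x : A, g x (z + t • ones _)) ≤ (⨅ x : A, g x z) - t := fun z t => by
    rw [le_sub_iff_add_le]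
    refine le_ciInf fun x => ?_
    rw [← le_sub_iff_add_le]
    refine (ciInf_le (hbdd _) x).trans (Finset.sup'_le _ _ fun j _ => ?_)
    have := hg x z j
    simp only [PiLp.add_apply, PiLp.smul_apply, ones_apply, smul_eq_mul]
    linarith
  refine ⟨fun z => ⨅ x : A, g x z, ⟨hanti, fun z t => le_antisymm (hle z t) ?_⟩, fun z hz => ?_⟩
  · have := hle (z + t • ones _) (-t)
    rw [neg_smul, add_neg_cancel_right] at this
    linarith
  · refine le_antisymm ?_ (le_ciInf fun x => ?_)
    · refine (ciInf_le (hbdd z) ⟨z, hz⟩).trans (Finset.sup'_le _ _ fun j _ => ?_)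
      simp
    · by_contra! hlt
      have hxz : CoordLE x.1 z := fun j => by
        have := hg x z j
        linarith
      have hxe : x.1 = z := hA.eq x.2 hz hxz
      have := hg x z 0
      rw [hxe, sub_self] at this
      rw [hxe] at hlt
      linarith

/-- Prepending a zero coordinate. -/
noncomputable def consZero (n : ℕ) :
    EuclideanSpace ℝ (Fin n) →L[ℝ] EuclideanSpace ℝ (Fin (n + 1)) :=
  LinearMap.toContinuousLinearMap
    { toFun := fun q => WithLp.toLp 2 (Fin.cases 0 q)
      map_add' := fun x y => by ext j; refine Fin.cases ?_ (fun j => ?_) j <;> simp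
      map_smul' := fun c x => by ext j; refine Fin.cases ?_ (fun j => ?_) j <;> simp }

@[simp] theorem consZero_zero {n : ℕ} (q : EuclideanSpace ℝ (Fin n)) : consZero n q 0 = 0 := rfl

@[simp] theorem consZero_succ {n : ℕ} (q : EuclideanSpace ℝ (Fin n)) (j : Fin n) :
    consZero n q j.succ = q j := rfl

/-- Projection to the last `n` coordinates along the diagonal. -/
noncomputable def diagProj (n : ℕ) :
    EuclideanSpace ℝ (Fin (n + 1)) →L[ℝ] EuclideanSpace ℝ (Fin n) :=
  LinearMap.toContinuousLinearMap
    { toFun := fun z => WithLp.toLp 2 fun j => z j.succ - z 0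
      map_add' := fun x y => by ext j; simp; ring
      map_smul' := fun c x => by ext j; simp; ring }

@[simp] theorem diagProj_apply {n : ℕ} (z : EuclideanSpace ℝ (Fin (n + 1))) (j : Fin n) :
    diagProj n z j = z j.succ - z 0 := rfl

theorem consZero_diagProj {n : ℕ} (z : EuclideanSpace ℝ (Fin (n + 1))) :
    consZero n (diagProj n z) = z + (-z 0) • ones (n + 1) := by
  ext j
  refine Fin.cases ?_ (fun j => ?_) j <;> simp [sub_eq_add_neg]

/-- Parametrization of the zero set of `h` by `n` coordinates along the diagonal. -/
noncomputable def heightParam {n : ℕ} (h : EuclideanSpace ℝ (Fin (n + 1)) → ℝ)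
    (q : EuclideanSpace ℝ (Fin n)) : EuclideanSpace ℝ (Fin (n + 1)) :=
  consZero n q + h (consZero n q) • ones (n + 1)

namespace IsHeight

/-- Moving `z` up the diagonal by `dist z w` puts it above `w`, because coordinates are bounded by
the norm. -/
theorem lipschitzWith {n : ℕ} {h : EuclideanSpace ℝ (Fin n) → ℝ} (hh : IsHeight h) :
    LipschitzWith 1 h := by
  refine LipschitzWith.of_le_add_mul 1 fun z w => ?_
  have h1 : CoordLE w (z + dist z w • ones n) := fun j => by
    have h2 := PiLp.norm_apply_le (z - w) j
    rw [Real.norm_eq_abs, ← dist_eq_norm, PiLp.sub_apply] at h2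
    have := (abs_le.1 h2).1
    simp only [PiLp.add_apply, PiLp.smul_apply, ones_apply, smul_eq_mul, mul_one]
    linarith
  have h3 := hh.anti _ _ h1
  rw [hh.add_smul_ones] at h3
  simp only [NNReal.coe_one, one_mul]
  linarith

variable {n : ℕ} {h : EuclideanSpace ℝ (Fin (n + 1)) → ℝ}

theorem diagProj_heightParam (q : EuclideanSpace ℝ (Fin n)) :
    diagProj n (heightParam h q) = q := by
  ext j
  simp [heightParam]

theorem heightParam_diagProj (hh : IsHeight h) {z : EuclideanSpace ℝ (Fin (n + 1))} (hz : h z = 0) :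
    heightParam h (diagProj n z) = z := by
  rw [heightParam, consZero_diagProj, hh.add_smul_ones, hz]
  simp

theorem apply_heightParam (hh : IsHeight h) (q : EuclideanSpace ℝ (Fin n)) : h (heightParam h q) = 0 := by
  rw [heightParam, hh.add_smul_ones, sub_self]

theorem exists_lipschitzWith_heightParam (hh : IsHeight h) : ∃ C, LipschitzWith C (heightParam h) :=
  ⟨_, (consZero n).lipschitz.add
    (((ContinuousLinearMap.toSpanSingleton ℝ (ones (n + 1))).lipschitz.comp
      (hh.lipschitzWith.comp (consZero n).lipschitz)))⟩

theorem norm_sub_le_heightParam (p q : EuclideanSpace ℝ (Fin n)) :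
    ‖p - q‖ ≤ ‖diagProj n‖₊ * ‖heightParam h p - heightParam h q‖ := by
  have := (diagProj n).le_opNorm (heightParam h p - heightParam h q)
  rwa [map_sub, diagProj_heightParam, diagProj_heightParam] at this

end IsHeight

/-! ### Injectivity of the projections and conclusion -/

namespace IsHeight

variable {n : ℕ} {h : EuclideanSpace ℝ (Fin (n + 1)) → ℝ}

/-- Antitonicity squeezes `h` to zero on the whole segment between the two comparable boundary
points. The parametrization is therefore affine from `p` to `q`, with constant `i`-th projection. -/
theorem map_sub_eq_zero_of_coordLE (hh : IsHeight h) (i : Fin (n + 1))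
    {p q : EuclideanSpace ℝ (Fin n)}
    {M : EuclideanSpace ℝ (Fin n) →L[ℝ] EuclideanSpace ℝ (Fin (n + 1))}
    (hM : HasFDerivAt (heightParam h) M p)
    (hpq : proj i (heightParam h p) = proj i (heightParam h q))
    (hle : CoordLE (heightParam h p) (heightParam h q)) :
    (projCLM i ∘L M) (q - p) = 0 := by
  set x := heightParam h p with hx
  set y := heightParam h q with hy
  have hseg : ∀ s ∈ Icc (0 : ℝ) 1, heightParam h (p + s • (q - p)) = x + s • (y - x) := by
    intro s hs
    have hz : h (x + s • (y - x)) = 0 := by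
      refine le_antisymm ?_ ?_
      · rw [← hh.apply_heightParam p]
        refine hh.anti _ _ fun j => ?_
        have := mul_nonneg hs.1 (sub_nonneg.2 (hle j))
        simp only [← hx, PiLp.add_apply, PiLp.smul_apply, PiLp.sub_apply, smul_eq_mul]
        linarith
      · rw [← hh.apply_heightParam q]
        refine hh.anti _ _ fun j => ?_
        have := mul_nonneg (sub_nonneg.2 hs.2) (sub_nonneg.2 (hle j))
        simp only [PiLp.add_apply, PiLp.smul_apply, PiLp.sub_apply, smul_eq_mul]
        linarith
    have := hh.heightParam_diagProj hz
    rwa [map_add, map_smul, map_sub, hx, hy, diagProj_heightParam, diagProj_heightParam] at this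
  have hcurve : HasDerivAt (fun s : ℝ => p + s • (q - p)) (q - p) 0 := by
    simpa using ((hasDerivAt_id (0 : ℝ)).smul_const (q - p)).const_add p
  have hproj : HasFDerivAt (fun w => projCLM i (heightParam h w)) (projCLM i ∘L M)
      (p + (0 : ℝ) • (q - p)) := by
    rw [zero_smul, add_zero]
    exact (projCLM i).hasFDerivAt.comp p hM
  -- The segment formula holds only for `s` in `[0, 1]`, so derivatives at `0` are compared
  -- one-sidedly.
  have hd := (hproj.comp_hasDerivAt (0 : ℝ) hcurve).hasDerivWithinAt (s := Icc 0 1)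
  have hconst : HasDerivWithinAt (fun _ : ℝ => projCLM i x) 0 (Icc 0 1) 0 :=
    hasDerivWithinAt_const ..
  refine (uniqueDiffOn_Icc zero_lt_one 0 (by simp)).eq_deriv _ hd (hconst.congr ?_ ?_)
  · intro s hs
    simp only [Function.comp_apply]
    rw [hseg s hs, map_add, map_smul, map_sub, projCLM_apply i y, projCLM_apply, hpq]
    simp
  · simp [hx]

/-- Points with equal `i`-th projection are comparable, and the derivative at the lower one would
have a kernel. -/
theorem injOn_proj_heightParam (hh : IsHeight h) (i : Fin (n + 1)) :
    InjOn (fun q => proj i (heightParam h q))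
      {q | DifferentiableAt ℝ (heightParam h) q ∧
        (projCLM i ∘L fderiv ℝ (heightParam h) q).det ≠ 0} := by
  have key : ∀ p q, DifferentiableAt ℝ (heightParam h) p →
      (projCLM i ∘L fderiv ℝ (heightParam h) p).det ≠ 0 →
      proj i (heightParam h p) = proj i (heightParam h q) →
      heightParam h p i ≤ heightParam h q i → p = q := by
    intro p q hp hdet hpq hi
    have hle : CoordLE (heightParam h p) (heightParam h q) := fun j => by
      rcases Fin.eq_self_or_eq_succAbove i j with rfl | ⟨k, rfl⟩
      · exact hi
      · exact (congrArg (fun w : EuclideanSpace ℝ (Fin n) => w k) hpq).le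
    by_contra hne
    have h0 := hh.map_sub_eq_zero_of_coordLE i hp.hasFDerivAt hpq hle
    refine hdet (LinearMap.det_eq_zero_iff_ker_ne_bot.2 fun hker => ?_)
    exact hne (sub_eq_zero.1 (LinearMap.ker_eq_bot'.1 hker _ h0)).symm
  rintro p ⟨hp, hp'⟩ q ⟨hq, hq'⟩ hpq
  rcases le_total (heightParam h p i) (heightParam h q i) with hle | hle
  · exact key p q hp hp' hpq hle
  · exact (key q p hq hq' hpq.symm hle).symm

theorem measurable_abs_det (i : Fin (n + 1)) :
    Measurable fun q => ENNReal.ofReal |(projCLM i ∘L fderiv ℝ (heightParam h) q).det| := by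
  have hdet : Continuous fun M : EuclideanSpace ℝ (Fin n) →L[ℝ] EuclideanSpace ℝ (Fin (n + 1)) =>
      (projCLM i ∘L M).det :=
    ContinuousLinearMap.continuous_det.comp (continuous_const.clm_comp continuous_id)
  exact (hdet.measurable.comp (measurable_fderiv ℝ _)).norm.ennreal_ofReal

theorem setLIntegral_abs_det_le (hh : IsHeight h) (i : Fin (n + 1))
    {S : Set (EuclideanSpace ℝ (Fin n))} (hS : MeasurableSet S)
    (hdiff : ∀ q ∈ S, DifferentiableAt ℝ (heightParam h) q) :
    ∫⁻ q in S, ENNReal.ofReal |(projCLM i ∘L fderiv ℝ (heightParam h) q).det| ∂μH[n] ≤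
      μH[n] ((fun q => proj i (heightParam h q)) '' S) := by
  set J : EuclideanSpace ℝ (Fin n) → ℝ≥0∞ := fun q =>
    ENNReal.ofReal |(projCLM i ∘L fderiv ℝ (heightParam h) q).det|
  have hJ : Measurable J := measurable_abs_det i
  have hsupp : MeasurableSet (Function.support J) := measurableSet_support hJ
  have hne : ∀ q ∈ Function.support J,
      (projCLM i ∘L fderiv ℝ (heightParam h) q).det ≠ 0 := fun q hq h0 => hq (by simp [J, h0])
  calc ∫⁻ q in S, J q ∂μH[n] = ∫⁻ q in S ∩ Function.support J, J q ∂μH[n] := by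
        conv_lhs => rw [← indicator_support (f := J)]
        rw [setLIntegral_indicator hsupp, inter_comm]
    _ = μH[n] ((fun q => proj i (heightParam h q)) '' (S ∩ Function.support J)) := by
        refine lintegral_abs_det_fderiv_eq_addHaar_image μH[n] (hS.inter hsupp)
          (f := fun q => proj i (heightParam h q)) (fun q hq => ?_) ?_
        · exact ((projCLM i).hasFDerivAt.comp q (hdiff q hq.1).hasFDerivAt).hasFDerivWithinAt
        · refine (hh.injOn_proj_heightParam i).mono fun q hq => ?_
          exact ⟨hdiff q hq.1, hne q hq.2⟩
    _ ≤ _ := measure_mono (image_mono inter_subset_left)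

theorem hausdorffMeasure_le_sum (hh : IsHeight h) {A : Set (EuclideanSpace ℝ (Fin (n + 1)))}
    (hA : ∀ z ∈ A, h z = 0) : μH[n] A ≤ ∑ i, μH[n] (proj i '' A) := by
  obtain ⟨C, hC⟩ := hh.exists_lipschitzWith_heightParam
  set D := {q | DifferentiableAt ℝ (heightParam h) q}
  have hD : MeasurableSet D := measurableSet_of_differentiableAt ℝ _
  -- `A` need not be measurable: the measurable hulls of its projections cut out a measurable
  -- parameter set without increasing the right-hand side.
  set S := D ∩ ⋂ i, (fun q => projCLM i (heightParam h q)) ⁻¹' toMeasurable μH[n] (proj i '' A)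
  have hS : MeasurableSet S := hD.inter <| MeasurableSet.iInter fun i =>
    ((projCLM i).continuous.comp hC.continuous).measurable (measurableSet_toMeasurable _ _)
  have hAsub : A ⊆ heightParam h '' S ∪ heightParam h '' Dᶜ := fun z hz => by
    have hzF := hh.heightParam_diagProj (hA z hz)
    by_cases hzD : diagProj n z ∈ D
    · refine Or.inl ⟨_, ⟨hzD, mem_iInter.2 fun i => ?_⟩, hzF⟩
      rw [mem_preimage, hzF]
      exact subset_toMeasurable _ _ ⟨z, hz, rfl⟩
    · exact Or.inr ⟨_, hzD, hzF⟩
  have hnull : μH[n] (heightParam h '' Dᶜ) = 0 := by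
    -- Rademacher's theorem.
    have h0 : μH[n] Dᶜ = 0 := hC.ae_differentiableAt
    refine le_antisymm ((hC.hausdorffMeasure_image_le n.cast_nonneg _).trans ?_) bot_le
    rw [h0, mul_zero]
  calc μH[n] A ≤ μH[n] (heightParam h '' S) + μH[n] (heightParam h '' Dᶜ) :=
        (measure_mono hAsub).trans (measure_union_le _ _)
    _ = μH[n] (heightParam h '' S) := by rw [hnull, add_zero]
    _ ≤ ∫⁻ q in S, ∑ i, ENNReal.ofReal
          |(projCLM i ∘L fderiv ℝ (heightParam h) q).det| ∂μH[n] :=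
        hausdorffMeasure_image_le_lintegral_sum_abs_det hS (fun q hq => hq.1.hasFDerivAt)
          norm_sub_le_heightParam
    _ = ∑ i, ∫⁻ q in S, ENNReal.ofReal
          |(projCLM i ∘L fderiv ℝ (heightParam h) q).det| ∂μH[n] :=
        lintegral_finsetSum _ fun i _ => measurable_abs_det i
    _ ≤ ∑ i, μH[n] (proj i '' A) := by
        refine Finset.sum_le_sum fun i _ =>
          (hh.setLIntegral_abs_det_le i hS fun q hq => hq.1).trans ?_
        rw [← measure_toMeasurable (proj i '' A)]
        refine measure_mono ?_
        rintro _ ⟨q, hq, rfl⟩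
        exact mem_iInter.1 hq.2 i

end IsHeight

end ProjAntichain

/-- The projection inequality for antichains in the unit cube of dimension `n + 1 ≥ 1`. -/
theorem proposition3p1 (n : ℕ) (A : Set (EuclideanSpace ℝ (Fin (n + 1))))
    (hcube : A ⊆ ProjAntichain.unitCube (n + 1))
    (hanti : IsAntichain ProjAntichain.CoordLE A) :
    ProjAntichain.hausdorff (n : ℝ) A
      ≤ ∑ i : Fin (n + 1), ProjAntichain.hausdorff (n : ℝ) (ProjAntichain.proj i '' A) := by
  simp only [ProjAntichain.hausdorff, ← Finset.mul_sum]
  gcongr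
  -- The infimum defining the height needs a point of `A`.
  rcases A.eq_empty_or_nonempty with rfl | hne
  · simp
  · obtain ⟨h, hh, hA⟩ := ProjAntichain.exists_isHeight hanti hcube hne
    exact hh.hausdorffMeasure_le_sum hA
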